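/- Let $R$ be a ring with identity. For a left Gabriel filter $\mathcal F_l$ and a right Gabriel filter $\mathcal F_r$ on $R$, let the induced symmetric filter $_l\mathcal F_r$ be the Gabriel filter of all right ideals of $R\otimes_{\mathbb Z}R^{op}$ that contain $J\otimes R^{op}+R\otimes I$ for some $I\in\mathcal F_l$ and $J\in\mathcal F_r$. An $R$-bimodule $M$ is regarded as a right $R\otimes_{\mathbb Z}R^{op}$-module by $x(r\otimes s)=sxr$. Let $_lt_r(M)$ be its torsion submodule with respect to $_l\mathcal F_r$ (the elements annihilated by some member of $_l\mathcal F_r$); $M$ is torsion-free if $_lt_r(M)=0$, and $_l\mathcal F_r$ is faithful if the bimodule $R$ is torsion-free. The symmetric module of quotients is $$_lM_r=\varinjlim_{K\in\,_l\mathcal F_r}\operatorname{Hom}\bigl(K,\,M/\,_lt_r(M)\bigr),$$ with canonical map $q_M:M\to\,_lM_r$; $_lR_r$ is a ring, the symmetric ring of quotients. A derivation $\delta$ on $R$ is an additive map with $\delta(rs)=\delta(r)s+r\delta(s)$. It induces the derivation $\overline\delta(r\otimes s)=\delta(r)\otimes s+r\otimes\delta(s)$ of $R\otimes_{\mathbb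 Z}R^{op}$. A $\delta$-derivation on a bimodule $M$ is an additive map $d:M\to M$ with $d(xr)=d(x)r+x\delta(r)$ and $d(rx)=\delta(r)x+rd(x)$ for all $x\in M$, $r\in R$. The filter $_l\mathcal F_r$ is differential if for every derivation $\delta$ on $R$ and every $K\in\,_l\mathcal F_r$ there is $L\in\,_l\mathcal F_r$ with $\overline\delta(L)\subseteq K$. Let $_l\mathcal F_r^1\subseteq\,_l\mathcal F_r^2$ be symmetric filters induced by left and right Gabriel filters $\mathcal F_l^1,\mathcal F_r^1$ and $\mathcal F_l^2,\mathcal F_r^2$ on $R$. For a bimodule $M$ let $_lM_r^1$, $_lM_r^2$ be the symmetric modules of quotients, $q_i:M\to\,_lM_r^i$ the canonical maps, and $q_{12}:\,_lM_r^1\to\,_lM_r^2$ the natural map induced by the inclusion of filters, so that $q_{12}q_1=q_2$. **(a)** Suppose that $_l\mathcal F_r^1$ is differential, that $M$ is an $R$-bimodule, and that either i) $_lM_r^1$ is torsion-free with respect to $_l\mathcal F_r^2$, or ii) $_l\mathcal F_r^2$ is differential. Then for every derivation $\delta$ on $R$ and every $\delta$-derivation $d$ on $M$ there are $\delta$-derivations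 $d_1$ on $_lM_r^1$ and $d_2$ on $_lM_r^2$ that extend $d$ and agree, that is, $$d_1q_1=q_1d,\qquad d_2q_2=q_2d,\qquad d_2q_{12}=q_{12}d_1 .$$ **(b)** Suppose that either $_l\mathcal F_r^1$ is differential and i) or ii) holds for $M=R$, or iii) $_l\mathcal F_r^1$ and $_l\mathcal F_r^2$ are both faithful. Then every derivation $\delta$ on $R$ extends to derivations $d_1$ of the ring $_lR_r^1$ and $d_2$ of the ring $_lR_r^2$, which are also $\delta$-derivations of bimodules, and these extensions agree, that is, $d_1q_1=q_1\delta$, $d_2q_2=q_2\delta$ and $d_2q_{12}=q_{12}d_1$. -/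

import Mathlib

open scoped TensorProduct

noncomputable section

namespace TorsionQuotient

universe u v w

/-! ## Modules of quotients with respect to a Gabriel filter of left ideals -/

section Generic

variable {A : Type u} [Ring A] (F : IdealFilter A) [F.IsGabriel]

/-- The torsion submodule of a left module: all elements annihilated by a member of the filter. -/
def torsion (M : Type v) [AddCommGroup M] [Module A M] : Submodule A M where
  carrier := {m | F.IsTorsionElem m}
  add_mem' := by
    rintro x y ⟨I, hI, hx⟩ ⟨J, hJ, hy⟩
    exact ⟨I ⊓ J, F.inf_mem hI hJ, fun a ha => by rw [smul_add, hx a ha.1, hy a ha.2, add_zero]⟩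
  zero_mem' := ⟨⊤, F.top_mem, fun a _ => smul_zero a⟩
  smul_mem' := by
    rintro c x ⟨I, hI, hx⟩
    exact ⟨I.colon {c}, IdealFilter.IsUniform.colon_mem hI c, fun a ha => by
      rw [smul_smul]; exact hx _ (Submodule.mem_colon_singleton.mp ha)⟩

/-- A module is torsion-free if its torsion submodule is zero. -/
def IsTorsionFree (M : Type v) [AddCommGroup M] [Module A M] : Prop :=
  torsion F M = ⊥

/-- The members of the filter, ordered by reverse inclusion. -/
abbrev Index : Type u := {K : Ideal A // K ∈ F}ᵒᵈ

instance : Nonempty (Index F) := ⟨OrderDual.toDual ⟨⊤, F.top_mem⟩⟩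

instance : IsDirectedOrder (Index F) :=
  ⟨fun a b => ⟨OrderDual.toDual ⟨a.ofDual.1 ⊓ b.ofDual.1, F.inf_mem a.ofDual.2 b.ofDual.2⟩,
    (inf_le_left : a.ofDual.1 ⊓ b.ofDual.1 ≤ a.ofDual.1),
    (inf_le_right : a.ofDual.1 ⊓ b.ofDual.1 ≤ b.ofDual.1)⟩⟩

instance : DecidableEq (Index F) := Classical.decEq _

section

variable (M : Type v) [AddCommGroup M] [Module A M]

/-- The group `Hom_A(K, M / t(M))` for a member `K` of the filter. -/
abbrev HomAt (K : Index F) : Type (max u v) := (K.ofDual.1 : Ideal A) →ₗ[A] (M ⧸ torsion F M)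

/-- Restriction of homomorphisms to a smaller member of the filter. -/
def restr (K L : Index F) (h : K ≤ L) : HomAt F M K →+ HomAt F M L where
  toFun f := f ∘ₗ Submodule.inclusion (h : L.ofDual.1 ≤ K.ofDual.1)
  map_zero' := rfl
  map_add' _ _ := rfl

instance : DirectedSystem (HomAt F M) fun K L h => restr F M K L h where
  map_self _ _ := rfl
  map_map _ _ _ _ _ _ := rfl

/-- The module of quotients `M_F`, the direct limit of the groups `Hom_A(K, M / t(M))` over the
members `K` of the filter `F`. -/
def ModQuot : Type (max u v) := AddCommGroup.DirectLimit (HomAt F M) (restr F M)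

instance : AddCommGroup (ModQuot F M) :=
  inferInstanceAs (AddCommGroup (AddCommGroup.DirectLimit (HomAt F M) (restr F M)))

end

variable {F} {M : Type v} [AddCommGroup M] [Module A M]

/-- The class in `M_F` of a homomorphism `K → M / t(M)`. -/
def germ {K : Ideal A} (hK : K ∈ F) : (K →ₗ[A] (M ⧸ torsion F M)) →+ ModQuot F M :=
  AddCommGroup.DirectLimit.of (HomAt F M) (restr F M) (OrderDual.toDual ⟨K, hK⟩)

theorem exists_germ (z : ModQuot F M) :
    ∃ (K : Ideal A) (hK : K ∈ F) (f : K →ₗ[A] (M ⧸ torsion F M)), germ hK f = z := by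
  refine AddCommGroup.DirectLimit.induction_on z fun i x => ?_
  exact ⟨i.ofDual.1, i.ofDual.2, x, rfl⟩

theorem germ_restrict {K L : Ideal A} (hK : K ∈ F) (hL : L ∈ F) (h : L ≤ K)
    (f : K →ₗ[A] (M ⧸ torsion F M)) :
    germ hL (f ∘ₗ Submodule.inclusion h) = germ hK f :=
  AddCommGroup.DirectLimit.of_f (G := HomAt F M) (f := restr F M)
    (i := OrderDual.toDual ⟨K, hK⟩) (j := OrderDual.toDual ⟨L, hL⟩) h f

theorem germ_eq_of {K L P : Ideal A} (hK : K ∈ F) (hL : L ∈ F) (hP : P ∈ F)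
    {f : K →ₗ[A] (M ⧸ torsion F M)} {g : L →ₗ[A] (M ⧸ torsion F M)}
    (h : ∀ x (h₁ : x ∈ K) (h₂ : x ∈ L), x ∈ P → f ⟨x, h₁⟩ = g ⟨x, h₂⟩) :
    germ hK f = germ hL g := by
  have hW : K ⊓ L ⊓ P ∈ F := F.inf_mem (F.inf_mem hK hL) hP
  rw [← germ_restrict hK hW (inf_le_left.trans inf_le_left) f,
    ← germ_restrict hL hW (inf_le_left.trans inf_le_right) g]
  congr 1
  ext x
  exact h x.1 x.2.1.1 x.2.1.2 x.2.2

theorem germ_eq_zero {K : Ideal A} (hK : K ∈ F) {f : K →ₗ[A] (M ⧸ torsion F M)}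
    (h : germ hK f = 0) : ∃ L ∈ F, ∀ x (h₁ : x ∈ K), x ∈ L → f ⟨x, h₁⟩ = 0 := by
  obtain ⟨L, hL, e⟩ := AddCommGroup.DirectLimit.of.zero_exact (G := HomAt F M) (f := restr F M) _ _ h
  refine ⟨L.ofDual.1, L.ofDual.2, fun x h₁ h₂ => ?_⟩
  exact LinearMap.congr_fun e ⟨x, h₂⟩

/-- For `f : K → M / t(M)` the homomorphism `x ↦ f (x a)` on `(K : a) = {x | x a ∈ K}`. -/
def shift (a : A) (K : Ideal A) :
    (K →ₗ[A] (M ⧸ torsion F M)) →+ ((K.colon {a} : Ideal A) →ₗ[A] (M ⧸ torsion F M)) where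
  toFun f :=
    { toFun := fun x => f ⟨x.1 * a, Submodule.mem_colon_singleton.mp x.2⟩
      map_add' := fun x y => by rw [← map_add]; congr 1; ext; simp [add_mul]
      map_smul' := fun c x => by
        rw [RingHom.id_apply, ← map_smul]; congr 1; ext; simp [mul_assoc] }
  map_zero' := rfl
  map_add' _ _ := rfl

@[simp] theorem shift_apply (a : A) (K : Ideal A) (f : K →ₗ[A] (M ⧸ torsion F M))
    (x : (K.colon {a} : Ideal A)) :
    shift a K f x = f ⟨x.1 * a, Submodule.mem_colon_singleton.mp x.2⟩ := rfl

/-- Multiplication by `a` on `M_F`: the class of `f : K → M / t(M)` is sent to the class of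
`x ↦ f (x a)` on `(K : a)`. -/
def smulHom (a : A) : ModQuot F M →+ ModQuot F M :=
  AddCommGroup.DirectLimit.lift (HomAt F M) (restr F M) (ModQuot F M)
    (fun K => (germ (IdealFilter.IsUniform.colon_mem K.ofDual.2 a)).comp (shift a K.ofDual.1))
    (fun K L h f => by
      refine germ_eq_of _ _ F.top_mem fun x h₁ h₂ _ => ?_
      rfl)

theorem smulHom_germ (a : A) {K : Ideal A} (hK : K ∈ F) (f : K →ₗ[A] (M ⧸ torsion F M)) :
    smulHom a (germ hK f) = germ (IdealFilter.IsUniform.colon_mem hK a) (shift a K f) :=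
  AddCommGroup.DirectLimit.lift_of (G := HomAt F M) (f := restr F M) _ _ _
    (OrderDual.toDual ⟨K, hK⟩) f

instance : Module A (ModQuot F M) where
  smul a z := smulHom a z
  smul_zero a := map_zero (smulHom a)
  smul_add a := map_add (smulHom a)
  one_smul z := by
    obtain ⟨K, hK, f, rfl⟩ := exists_germ z
    refine (smulHom_germ _ _ _).trans (germ_eq_of _ _ F.top_mem fun x h₁ h₂ _ => ?_)
    simp
  mul_smul a b z := by
    obtain ⟨K, hK, f, rfl⟩ := exists_germ z
    change smulHom (a * b) _ = smulHom a (smulHom b _)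
    rw [smulHom_germ, smulHom_germ, smulHom_germ]
    refine germ_eq_of _ _ F.top_mem fun x h₁ h₂ _ => ?_
    simp [mul_assoc]
  add_smul a b z := by
    obtain ⟨K, hK, f, rfl⟩ := exists_germ z
    change smulHom (a + b) _ = smulHom a _ + smulHom b _
    rw [smulHom_germ, smulHom_germ, smulHom_germ]
    have ha := IdealFilter.IsUniform.colon_mem hK a
    have hb := IdealFilter.IsUniform.colon_mem hK b
    have hW := F.inf_mem ha hb
    rw [← germ_restrict ha hW inf_le_left, ← germ_restrict hb hW inf_le_right, ← map_add]
    refine germ_eq_of _ _ F.top_mem fun x h₁ h₂ _ => ?_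
    simp only [shift_apply, LinearMap.add_apply, LinearMap.comp_apply]
    rw [← map_add]
    congr 1
    ext
    simp [mul_add]
  zero_smul z := by
    obtain ⟨K, hK, f, rfl⟩ := exists_germ z
    refine (smulHom_germ _ _ _).trans ?_
    rw [← map_zero (germ (M := M) F.top_mem)]
    refine germ_eq_of _ _ F.top_mem fun x h₁ h₂ _ => ?_
    simp only [shift_apply, mul_zero, LinearMap.zero_apply]
    exact map_zero f

theorem smul_germ (a : A) {K : Ideal A} (hK : K ∈ F) (f : K →ₗ[A] (M ⧸ torsion F M)) :
    a • germ hK f = germ (IdealFilter.IsUniform.colon_mem hK a) (shift a K f) :=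
  smulHom_germ a hK f

variable (F M)

/-- The map `M / t(M) → M_F` sending an element `y` to the class of `x ↦ x y`. -/
def iota : (M ⧸ torsion F M) →ₗ[A] ModQuot F M where
  toFun y := germ F.top_mem ((LinearMap.toSpanSingleton A _ y) ∘ₗ Submodule.subtype ⊤)
  map_add' y z := by
    rw [← map_add]; congr 1; ext x; simp
  map_smul' a y := by
    rw [RingHom.id_apply, smul_germ]
    refine germ_eq_of _ _ F.top_mem fun x h₁ h₂ _ => ?_
    simp [mul_smul]

/-- The canonical map `q_M : M → M_F`. -/
def toQuot : M →ₗ[A] ModQuot F M := iota F M ∘ₗ (torsion F M).mkQ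

variable {F M}

theorem smul_germ_mem {K : Ideal A} (hK : K ∈ F) (f : K →ₗ[A] (M ⧸ torsion F M))
    (a : A) (ha : a ∈ K) : a • germ hK f = iota F M (f ⟨a, ha⟩) := by
  rw [smul_germ]
  refine germ_eq_of _ _ F.top_mem fun x h₁ h₂ _ => ?_
  simp only [shift_apply, LinearMap.comp_apply, LinearMap.toSpanSingleton_apply,
    Submodule.subtype_apply]
  rw [← map_smul]
  rfl

theorem eq_zero_of_iota {y : M ⧸ torsion F M} (h : iota F M y = 0) : y = 0 := by
  obtain ⟨L, hL, e⟩ := germ_eq_zero _ h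
  obtain ⟨m, rfl⟩ := Submodule.Quotient.mk_surjective _ y
  rw [Submodule.Quotient.mk_eq_zero]
  -- `m` is torsion because the ideal annihilating it belongs to the filter
  refine ⟨LinearMap.ker (LinearMap.toSpanSingleton A M m),
    IdealFilter.IsGabriel.gabriel_closed _ ⟨L, hL, fun x hx => ?_⟩, fun a ha => by simpa using ha⟩
  have := e x trivial hx
  simp only [LinearMap.comp_apply, LinearMap.toSpanSingleton_apply, Submodule.subtype_apply,
    ← Submodule.Quotient.mk_smul, Submodule.Quotient.mk_eq_zero] at this
  obtain ⟨J, hJ, h⟩ := this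
  refine Order.PFilter.mem_of_le (fun a ha => ?_) hJ
  rw [Submodule.mem_colon_singleton]
  simpa [mul_smul] using h a ha

theorem iota_injective : Function.Injective (iota F M) :=
  (injective_iff_map_eq_zero _).mpr fun _ => eq_zero_of_iota

theorem toQuot_eq_zero {m : M} : toQuot F M m = 0 ↔ F.IsTorsionElem m := by
  constructor
  · intro h
    exact (Submodule.Quotient.mk_eq_zero (torsion F M)).mp (eq_zero_of_iota h)
  · intro h
    have : (torsion F M).mkQ m = 0 := (Submodule.Quotient.mk_eq_zero (torsion F M)).mpr h
    simp [toQuot, this]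

/-- The cokernel of `q_M` is torsion. -/
theorem exists_smul_mem_range (z : ModQuot F M) :
    ∃ K ∈ F, ∀ a ∈ K, ∃ m, a • z = toQuot F M m := by
  obtain ⟨K, hK, f, rfl⟩ := exists_germ z
  refine ⟨K, hK, fun a ha => ?_⟩
  obtain ⟨m, hm⟩ := Submodule.Quotient.mk_surjective _ (f ⟨a, ha⟩)
  exact ⟨m, by rw [smul_germ_mem hK f a ha, ← hm]; rfl⟩

/-- `M_F` is torsion-free. -/
theorem eq_zero_of_smul {L : Ideal A} (hL : L ∈ F) {z : ModQuot F M} (h : ∀ a ∈ L, a • z = 0) :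
    z = 0 := by
  obtain ⟨K, hK, f, rfl⟩ := exists_germ z
  rw [← map_zero (germ (M := M) hK)]
  refine germ_eq_of _ _ hL fun x h₁ h₂ hx => ?_
  have := h x hx
  rw [smul_germ_mem hK f x h₁] at this
  exact eq_zero_of_iota this

theorem eq_of_smul {L : Ideal A} (hL : L ∈ F) {z w : ModQuot F M}
    (h : ∀ a ∈ L, a • z = a • w) : z = w :=
  sub_eq_zero.mp (eq_zero_of_smul hL fun a ha => by rw [smul_sub, h a ha, sub_self])

/-- Every homomorphism from a member of the filter to `M_F` is a multiplication. -/
theorem exists_eq_smul {K : Ideal A} (hK : K ∈ F) (h : K →ₗ[A] ModQuot F M) :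
    ∃ z : ModQuot F M, ∀ a (ha : a ∈ K), a • z = h ⟨a, ha⟩ := by
  let L : Ideal A := ((LinearMap.range (iota F M)).comap h).map K.subtype
  have memL : ∀ x, x ∈ L ↔ ∃ hx : x ∈ K, h ⟨x, hx⟩ ∈ LinearMap.range (iota F M) := by
    intro x
    simp [L]
  have hL : L ∈ F := by
    refine IdealFilter.IsGabriel.gabriel_closed _ ⟨K, hK, fun x hx => ?_⟩
    obtain ⟨J, hJ, e⟩ := exists_smul_mem_range (h ⟨x, hx⟩)
    refine Order.PFilter.mem_of_le (fun a ha => ?_) hJ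
    rw [Submodule.mem_colon_singleton, memL]
    obtain ⟨m, hm⟩ := e a ha
    refine ⟨K.mul_mem_left a hx, (torsion F M).mkQ m, ?_⟩
    have : (⟨a • x, K.mul_mem_left a hx⟩ : K) = a • ⟨x, hx⟩ := rfl
    rw [this, map_smul, hm]
    rfl
  have hLK : L ≤ K := fun x hx => ((memL x).mp hx).1
  let e := LinearEquiv.ofInjective (iota F M) iota_injective
  let f : L →ₗ[A] (M ⧸ torsion F M) := e.symm.toLinearMap ∘ₗ
    LinearMap.codRestrict (LinearMap.range (iota F M)) (h ∘ₗ Submodule.inclusion hLK)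
      (fun x => ((memL x.1).mp x.2).2)
  have hf : ∀ x (hx : x ∈ L), x • germ hL f = h ⟨x, hLK hx⟩ := by
    intro x hx
    rw [smul_germ_mem hL f x hx]
    exact congrArg Subtype.val (e.apply_symm_apply _)
  refine ⟨germ hL f, fun a ha => ?_⟩
  refine eq_of_smul (IdealFilter.IsUniform.colon_mem hL a) fun b hb => ?_
  have hb' : b * a ∈ L := Submodule.mem_colon_singleton.mp hb
  rw [smul_smul, hf _ hb', ← map_smul]
  rfl

/-! ### Passing to a larger filter -/

section Transition

variable {G : IdealFilter A} [G.IsGabriel] (h : F ≤ G) (M)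

/-- The natural map `M / t_F(M) → M / t_G(M)` for filters `F ⊆ G`. -/
def torsionFactor : (M ⧸ torsion F M) →ₗ[A] (M ⧸ torsion G M) :=
  Submodule.factor (show torsion F M ≤ torsion G M from fun _ ⟨L, hL, hx⟩ => ⟨L, h hL, hx⟩)

/-- Composition of a homomorphism `K → M / t_F(M)` with `M / t_F(M) → M / t_G(M)`. -/
def postFactor (K : Ideal A) :
    (K →ₗ[A] (M ⧸ torsion F M)) →+ (K →ₗ[A] (M ⧸ torsion G M)) where
  toFun f := torsionFactor M h ∘ₗ f
  map_zero' := LinearMap.comp_zero _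
  map_add' _ _ := LinearMap.comp_add _ _ _

/-- The natural map `M_F → M_G` for filters `F ⊆ G`: the class of `f : K → M / t_F(M)` is sent to
the class of the composition of `f` with `M / t_F(M) → M / t_G(M)`. -/
def transitionHom : ModQuot F M →+ ModQuot G M :=
  AddCommGroup.DirectLimit.lift (HomAt F M) (restr F M) (ModQuot G M)
    (fun K => (germ (h K.ofDual.2)).comp (postFactor M h K.ofDual.1))
    (fun K L h' f => germ_restrict (h K.ofDual.2) (h L.ofDual.2) h' (torsionFactor M h ∘ₗ f))

theorem transitionHom_germ {K : Ideal A} (hK : K ∈ F) (f : K →ₗ[A] (M ⧸ torsion F M)) :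
    transitionHom M h (germ hK f) = germ (h hK) (torsionFactor M h ∘ₗ f) :=
  AddCommGroup.DirectLimit.lift_of (G := HomAt F M) (f := restr F M) _ _ _
    (OrderDual.toDual ⟨K, hK⟩) f

theorem transitionHom_smul (a : A) (z : ModQuot F M) :
    transitionHom M h (a • z) = a • transitionHom M h z := by
  obtain ⟨K, hK, f, rfl⟩ := exists_germ z
  rw [smul_germ, transitionHom_germ, transitionHom_germ, smul_germ]
  exact germ_eq_of _ _ G.top_mem fun _ _ _ _ => rfl

theorem transitionHom_toQuot (m : M) : transitionHom M h (toQuot F M m) = toQuot G M m := by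
  refine (transitionHom_germ M h _ _).trans ?_
  refine germ_eq_of _ _ G.top_mem fun x _ _ _ => ?_
  simp only [LinearMap.comp_apply, LinearMap.toSpanSingleton_apply, Submodule.subtype_apply,
    map_smul]
  rfl

end Transition

/-! ### Extension of homomorphisms -/

section Extend

variable {N : Type*} {P : Type*} [AddCommGroup N] [Module A N] [AddCommGroup P] [Module A P]
  {φ : N →ₗ[A] P}

theorem hom_ext_of_torsion (hc : ∀ p : P, ∃ K ∈ F, ∀ a ∈ K, ∃ n, a • p = φ n)
    {g g' : P →ₗ[A] ModQuot F M} (h : ∀ n, g (φ n) = g' (φ n)) : g = g' := by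
  ext p
  obtain ⟨K, hK, e⟩ := hc p
  refine eq_of_smul hK fun a ha => ?_
  obtain ⟨n, hn⟩ := e a ha
  rw [← map_smul, ← map_smul, hn, h]

theorem exists_extension (hk : ∀ n, φ n = 0 → F.IsTorsionElem n)
    (hc : ∀ p : P, ∃ K ∈ F, ∀ a ∈ K, ∃ n, a • p = φ n) (g : N →ₗ[A] ModQuot F M) :
    ∃ g' : P →ₗ[A] ModQuot F M, ∀ n, g' (φ n) = g n := by
  have hg : ∀ n n', φ n = φ n' → g n = g n' := by
    intro n n' e
    obtain ⟨L, hL, h⟩ := hk (n - n') (by rw [map_sub, e, sub_self])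
    refine eq_of_smul hL fun a ha => ?_
    rw [← sub_eq_zero, ← smul_sub, ← map_sub, ← map_smul, h a ha, map_zero]
  have key : ∀ p : P, ∃ z : ModQuot F M, ∀ (a : A) (n : N), a • p = φ n → a • z = g n := by
    intro p
    let K : Ideal A := (LinearMap.range φ).comap (LinearMap.toSpanSingleton A P p)
    have hK : K ∈ F := by
      obtain ⟨K', hK', e⟩ := hc p
      refine Order.PFilter.mem_of_le (fun a ha => ?_) hK'
      obtain ⟨n, hn⟩ := e a ha
      exact ⟨n, by simpa using hn.symm⟩
    have hK' : ∀ a : K, ∃ n, φ n = a.1 • p := fun a => by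
      obtain ⟨n, hn⟩ := a.2
      exact ⟨n, by simpa using hn⟩
    choose n hn using hK'
    let h : K →ₗ[A] ModQuot F M :=
      { toFun := fun a => g (n a)
        map_add' := fun a b => by
          rw [← map_add]
          exact hg _ _ (by rw [map_add, hn, hn, hn, ← add_smul]; rfl)
        map_smul' := fun c a => by
          rw [RingHom.id_apply, ← map_smul]
          exact hg _ _ (by rw [map_smul, hn, hn, smul_smul]; rfl) }
    obtain ⟨z, hz⟩ := exists_eq_smul hK h
    refine ⟨z, fun a m ham => ?_⟩
    have ha : a ∈ K := ⟨m, by simpa using ham.symm⟩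
    rw [hz a ha]
    exact hg _ _ (by rw [hn, ham])
  choose z hz using key
  refine ⟨{ toFun := z, map_add' := fun p p' => ?_, map_smul' := fun c p => ?_ }, fun n => ?_⟩
  · obtain ⟨K, hK, e⟩ := hc p
    obtain ⟨K', hK', e'⟩ := hc p'
    refine eq_of_smul (F.inf_mem hK hK') fun a ha => ?_
    obtain ⟨n, hn⟩ := e a ha.1
    obtain ⟨n', hn'⟩ := e' a ha.2
    rw [smul_add a (z p), hz p a n hn, hz p' a n' hn', ← map_add]
    exact hz _ _ _ (by rw [smul_add, hn, hn', map_add])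
  · obtain ⟨K, hK, e⟩ := hc p
    refine eq_of_smul (IdealFilter.IsUniform.colon_mem hK c) fun a ha => ?_
    obtain ⟨n, hn⟩ := e _ (Submodule.mem_colon_singleton.mp ha)
    rw [RingHom.id_apply, smul_smul, ← smul_eq_mul, hz p _ n hn]
    exact hz _ _ _ (by rw [smul_smul]; exact hn)
  · change z (φ n) = g n
    rw [← one_smul A (z (φ n))]
    exact hz _ _ _ (one_smul A _)

end Extend

end Generic
/-! ## Bimodules and symmetric filters -/

section Bimodule

open MulOpposite

variable (R : Type u) [Ring R]

/-- The enveloping ring `R ⊗ Rᵒᵖ`. An `R`-bimodule is a left module over it through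
`(r ⊗ s) x = r x s`. The swap of factors is an anti-isomorphism of this ring, so its left modules,
left ideals and filters of left ideals are the same as the right ones with the action
`x (r ⊗ s) = s x r`. -/
abbrev Env : Type u := R ⊗[ℤ] Rᵐᵒᵖ

variable {R}

/-- The ring homomorphism `r ↦ r ⊗ 1`. -/
def leftHom : R →+* Env R := Algebra.TensorProduct.includeLeftRingHom

/-- The ring homomorphism `s ↦ 1 ⊗ s`. -/
def rightHom : Rᵐᵒᵖ →+* Env R := (Algebra.TensorProduct.includeRight : Rᵐᵒᵖ →ₐ[ℤ] Env R).toRingHom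

theorem leftHom_apply (r : R) : leftHom r = (r ⊗ₜ[ℤ] 1 : Env R) := rfl

theorem rightHom_apply (s : Rᵐᵒᵖ) : rightHom s = ((1 : R) ⊗ₜ[ℤ] s : Env R) := rfl

theorem leftHom_mul_rightHom (r : R) (s : Rᵐᵒᵖ) :
    leftHom r * rightHom s = (r ⊗ₜ[ℤ] s : Env R) := by
  simp [leftHom_apply, rightHom_apply]

theorem rightHom_mul_leftHom (r : R) (s : Rᵐᵒᵖ) :
    rightHom s * leftHom r = (r ⊗ₜ[ℤ] s : Env R) := by
  simp [leftHom_apply, rightHom_apply]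

/-- The symmetric filter induced by a filter `Fl` of left ideals of `R` and a filter `Fr` of right
ideals of `R` (that is, of left ideals of `Rᵒᵖ`): it consists of the ideals of the enveloping ring
that contain (the image of) `I ⊗ Rᵒᵖ + R ⊗ J` for some `I ∈ Fl` and `J ∈ Fr`. -/
def symmetricFilter (Fl : IdealFilter R) (Fr : IdealFilter Rᵐᵒᵖ) : IdealFilter (Env R) :=
  Order.IsPFilter.toPFilter
    (F := {K : Ideal (Env R) | ∃ I ∈ Fl, ∃ J ∈ Fr, I.map leftHom ⊔ J.map rightHom ≤ K})
    (Order.IsPFilter.of_def ⟨⊤, ⊤, Fl.top_mem, ⊤, Fr.top_mem, le_top⟩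
      (by
        rintro K ⟨I, hI, J, hJ, h⟩ K' ⟨I', hI', J', hJ', h'⟩
        refine ⟨K ⊓ K', ⟨I ⊓ I', Fl.inf_mem hI hI', J ⊓ J', Fr.inf_mem hJ hJ', ?_⟩,
          inf_le_left, inf_le_right⟩
        exact le_inf ((sup_le_sup (Ideal.map_mono inf_le_left) (Ideal.map_mono inf_le_left)).trans h)
          ((sup_le_sup (Ideal.map_mono inf_le_right) (Ideal.map_mono inf_le_right)).trans h'))
      (by
        rintro K K' hK ⟨I, hI, J, hJ, h⟩
        exact ⟨I, hI, J, hJ, h.trans hK⟩))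

theorem mem_symmetricFilter {Fl : IdealFilter R} {Fr : IdealFilter Rᵐᵒᵖ} {K : Ideal (Env R)} :
    K ∈ symmetricFilter Fl Fr ↔ ∃ I ∈ Fl, ∃ J ∈ Fr, I.map leftHom ⊔ J.map rightHom ≤ K :=
  Iff.rfl

theorem mem_symmetricFilter_iff {Fl : IdealFilter R} {Fr : IdealFilter Rᵐᵒᵖ} {K : Ideal (Env R)} :
    K ∈ symmetricFilter Fl Fr ↔ K.comap leftHom ∈ Fl ∧ K.comap rightHom ∈ Fr := by
  rw [mem_symmetricFilter]
  constructor
  · rintro ⟨I, hI, J, hJ, h⟩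
    rw [sup_le_iff, Ideal.map_le_iff_le_comap, Ideal.map_le_iff_le_comap] at h
    exact ⟨Order.PFilter.mem_of_le h.1 hI, Order.PFilter.mem_of_le h.2 hJ⟩
  · rintro ⟨hI, hJ⟩
    exact ⟨_, hI, _, hJ, sup_le (Ideal.map_comap_le) (Ideal.map_comap_le)⟩

variable (Fl : IdealFilter R) (Fr : IdealFilter Rᵐᵒᵖ) [Fl.IsGabriel] [Fr.IsGabriel]

instance : (symmetricFilter Fl Fr).IsGabriel where
  colon_mem := by
    intro K hK t
    induction t using TensorProduct.induction_on with
    | zero =>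
      refine Order.PFilter.mem_of_le (fun a _ => ?_) hK
      rw [Submodule.mem_colon_singleton, smul_zero]
      exact K.zero_mem
    | tmul r s =>
      rw [mem_symmetricFilter_iff] at hK ⊢
      constructor
      · refine Order.PFilter.mem_of_le (fun a ha => ?_) (IdealFilter.IsUniform.colon_mem hK.1 r)
        rw [Submodule.mem_colon_singleton, Ideal.mem_comap] at ha
        rw [Ideal.mem_comap, Submodule.mem_colon_singleton, ← leftHom_mul_rightHom, smul_eq_mul,
          ← mul_assoc, ← map_mul, leftHom_mul_rightHom, ← rightHom_mul_leftHom]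
        exact K.mul_mem_left _ ha
      · refine Order.PFilter.mem_of_le (fun a ha => ?_) (IdealFilter.IsUniform.colon_mem hK.2 s)
        rw [Submodule.mem_colon_singleton, Ideal.mem_comap] at ha
        rw [Ideal.mem_comap, Submodule.mem_colon_singleton, ← rightHom_mul_leftHom, smul_eq_mul,
          ← mul_assoc, ← map_mul, rightHom_mul_leftHom, ← leftHom_mul_rightHom]
        exact K.mul_mem_left _ ha
    | add t t' ht ht' =>
      refine Order.PFilter.mem_of_le (fun a ha => ?_) ((symmetricFilter Fl Fr).inf_mem ht ht')
      rw [Submodule.mem_colon_singleton, smul_add]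
      exact K.add_mem (Submodule.mem_colon_singleton.mp ha.1)
        (Submodule.mem_colon_singleton.mp ha.2)
  gabriel_closed := by
    rintro L ⟨K, hK, h⟩
    rw [mem_symmetricFilter_iff] at hK ⊢
    constructor
    · refine IdealFilter.IsGabriel.gabriel_closed _ ⟨_, hK.1, fun x hx => ?_⟩
      refine Order.PFilter.mem_of_le (fun a ha => ?_) (mem_symmetricFilter_iff.mp (h _ hx)).1
      rw [Ideal.mem_comap, Submodule.mem_colon_singleton] at ha
      rw [Submodule.mem_colon_singleton, Ideal.mem_comap, smul_eq_mul, map_mul]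
      exact ha
    · refine IdealFilter.IsGabriel.gabriel_closed _ ⟨_, hK.2, fun x hx => ?_⟩
      refine Order.PFilter.mem_of_le (fun a ha => ?_) (mem_symmetricFilter_iff.mp (h _ hx)).2
      rw [Ideal.mem_comap, Submodule.mem_colon_singleton] at ha
      rw [Submodule.mem_colon_singleton, Ideal.mem_comap, smul_eq_mul, map_mul]
      exact ha

/-! ### Symmetric modules of quotients -/

section Quotients

attribute [local instance] TensorProduct.Algebra.module

variable (M : Type v) [AddCommGroup M] [Module R M] [Module Rᵐᵒᵖ M] [SMulCommClass R Rᵐᵒᵖ M]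

theorem leftHom_smul (r : R) (x : M) : leftHom r • x = r • x := by
  rw [leftHom_apply, TensorProduct.Algebra.smul_def, one_smul]

theorem rightHom_smul (s : Rᵐᵒᵖ) (x : M) : rightHom s • x = s • x := by
  rw [rightHom_apply, TensorProduct.Algebra.smul_def, one_smul]

/-- An `R`-bimodule is torsion-free for the symmetric filter if it has no nonzero element
annihilated by a member of the filter. -/
def SymTorsionFree : Prop := IsTorsionFree (symmetricFilter Fl Fr) M

/-- The symmetric module of quotients of an `R`-bimodule `M`: the direct limit of the groups of
bimodule homomorphisms `K → M / t(M)` over the members `K` of the symmetric filter. -/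
def SymQuot : Type (max u v) := ModQuot (symmetricFilter Fl Fr) M

instance : AddCommGroup (SymQuot Fl Fr M) :=
  inferInstanceAs (AddCommGroup (ModQuot (symmetricFilter Fl Fr) M))

/-- The action of the enveloping ring. -/
instance : Module (Env R) (SymQuot Fl Fr M) :=
  inferInstanceAs (Module (Env R) (ModQuot (symmetricFilter Fl Fr) M))

/-- The left action `r z = (r ⊗ 1) z`. -/
instance : Module R (SymQuot Fl Fr M) := Module.compHom _ leftHom

/-- The right action `z s = (1 ⊗ s) z`. -/
instance : Module Rᵐᵒᵖ (SymQuot Fl Fr M) := Module.compHom _ rightHom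

instance : SMulCommClass R Rᵐᵒᵖ (SymQuot Fl Fr M) where
  smul_comm r s z := by
    change leftHom r • rightHom s • z = rightHom s • leftHom r • z
    rw [smul_smul, smul_smul, leftHom_mul_rightHom, rightHom_mul_leftHom]

/-- The canonical map `q_M` from `M` to its symmetric module of quotients. -/
def toSymQuot : M →+ SymQuot Fl Fr M := (toQuot (symmetricFilter Fl Fr) M).toAddMonoidHom

/-- The canonical map `q₁₂` between the symmetric modules of quotients for symmetric filters such
that the first is contained in the second. -/
def symTransition {Fl₁ Fl₂ : IdealFilter R} {Fr₁ Fr₂ : IdealFilter Rᵐᵒᵖ}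
    [Fl₁.IsGabriel] [Fl₂.IsGabriel] [Fr₁.IsGabriel] [Fr₂.IsGabriel]
    (h : symmetricFilter Fl₁ Fr₁ ≤ symmetricFilter Fl₂ Fr₂) :
    SymQuot Fl₁ Fr₁ M →+ SymQuot Fl₂ Fr₂ M :=
  transitionHom M h

/-- `q₁₂ q₁ = q₂`. -/
theorem symTransition_toSymQuot {Fl₁ Fl₂ : IdealFilter R} {Fr₁ Fr₂ : IdealFilter Rᵐᵒᵖ}
    [Fl₁.IsGabriel] [Fl₂.IsGabriel] [Fr₁.IsGabriel] [Fr₂.IsGabriel]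
    (h : symmetricFilter Fl₁ Fr₁ ≤ symmetricFilter Fl₂ Fr₂) (m : M) :
    symTransition M h (toSymQuot Fl₁ Fr₁ M m) = toSymQuot Fl₂ Fr₂ M m :=
  transitionHom_toQuot M h m

variable {Fl Fr M}

theorem toSymQuot_smul (r : R) (m : M) :
    toSymQuot Fl Fr M (r • m) = r • toSymQuot Fl Fr M m := by
  rw [← leftHom_smul M r m]
  exact map_smul (toQuot (symmetricFilter Fl Fr) M) (leftHom r) m

theorem toSymQuot_op_smul (s : Rᵐᵒᵖ) (m : M) :
    toSymQuot Fl Fr M (s • m) = s • toSymQuot Fl Fr M m := by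
  rw [← rightHom_smul M s m]
  exact map_smul (toQuot (symmetricFilter Fl Fr) M) (rightHom s) m

theorem exists_left_of_toSymQuot_eq_zero {m : M} (h : toSymQuot Fl Fr M m = 0) :
    Fl.IsTorsionElem m := by
  obtain ⟨K, hK, e⟩ := toQuot_eq_zero.mp h
  exact ⟨_, (mem_symmetricFilter_iff.mp hK).1, fun a ha => by rw [← leftHom_smul]; exact e _ ha⟩

theorem exists_right_of_toSymQuot_eq_zero {m : M} (h : toSymQuot Fl Fr M m = 0) :
    Fr.IsTorsionElem m := by
  obtain ⟨K, hK, e⟩ := toQuot_eq_zero.mp h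
  exact ⟨_, (mem_symmetricFilter_iff.mp hK).2, fun a ha => by rw [← rightHom_smul]; exact e _ ha⟩

theorem exists_left_smul_mem (z : SymQuot Fl Fr M) :
    ∃ I ∈ Fl, ∀ a ∈ I, ∃ m, a • z = toSymQuot Fl Fr M m := by
  obtain ⟨K, hK, e⟩ := exists_smul_mem_range (F := symmetricFilter Fl Fr) (M := M) z
  exact ⟨_, (mem_symmetricFilter_iff.mp hK).1, fun a ha => e _ ha⟩

theorem exists_right_smul_mem (z : SymQuot Fl Fr M) :
    ∃ J ∈ Fr, ∀ a ∈ J, ∃ m, a • z = toSymQuot Fl Fr M m := by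
  obtain ⟨K, hK, e⟩ := exists_smul_mem_range (F := symmetricFilter Fl Fr) (M := M) z
  exact ⟨_, (mem_symmetricFilter_iff.mp hK).2, fun a ha => e _ ha⟩

/-- An element of the symmetric module of quotients that is torsion on both sides is zero. -/
theorem sym_eq_zero {z : SymQuot Fl Fr M} (hl : Fl.IsTorsionElem z) (hr : Fr.IsTorsionElem z) :
    z = 0 := by
  obtain ⟨I, hI, h⟩ := hl
  obtain ⟨J, hJ, h'⟩ := hr
  let K : Ideal (Env R) := LinearMap.ker (LinearMap.toSpanSingleton (Env R) (SymQuot Fl Fr M) z)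
  have hK : K ∈ symmetricFilter Fl Fr := by
    rw [mem_symmetricFilter_iff]
    refine ⟨Order.PFilter.mem_of_le (fun a ha => ?_) hI,
      Order.PFilter.mem_of_le (fun a ha => ?_) hJ⟩
    · rw [Ideal.mem_comap, LinearMap.mem_ker, LinearMap.toSpanSingleton_apply]
      exact h a ha
    · rw [Ideal.mem_comap, LinearMap.mem_ker, LinearMap.toSpanSingleton_apply]
      exact h' a ha
  exact eq_zero_of_smul (F := symmetricFilter Fl Fr) (M := M) hK fun a ha => ha

theorem sym_ext {z w : SymQuot Fl Fr M} {I : Ideal R} {J : Ideal Rᵐᵒᵖ} (hI : I ∈ Fl) (hJ : J ∈ Fr)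
    (hl : ∀ a ∈ I, a • z = a • w) (hr : ∀ a ∈ J, a • z = a • w) : z = w :=
  sub_eq_zero.mp (sym_eq_zero ⟨I, hI, fun a ha => by rw [smul_sub, hl a ha, sub_self]⟩
    ⟨J, hJ, fun a ha => by rw [smul_sub, hr a ha, sub_self]⟩)

end Quotients

/-! ### The symmetric ring of quotients -/

section Ring

variable {Fl : IdealFilter R} {Fr : IdealFilter Rᵐᵒᵖ} [Fl.IsGabriel] [Fr.IsGabriel]

theorem env_smul_left (r : R) (z : SymQuot Fl Fr R) : leftHom r • z = r • z := rfl

theorem env_smul_right (s : Rᵐᵒᵖ) (z : SymQuot Fl Fr R) : rightHom s • z = s • z := rfl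

theorem tmul_smul (r : R) (s : Rᵐᵒᵖ) (z : SymQuot Fl Fr R) :
    (r ⊗ₜ[ℤ] s : Env R) • z = r • s • z := by
  rw [← leftHom_mul_rightHom, mul_smul, env_smul_left, env_smul_right]

theorem toSymQuot_mul (r r' : R) :
    toSymQuot Fl Fr R (r * r') = r • toSymQuot Fl Fr R r' := toSymQuot_smul r r'

theorem toSymQuot_mul' (r r' : R) :
    toSymQuot Fl Fr R (r * r') = op r' • toSymQuot Fl Fr R r := toSymQuot_op_smul (op r') r

/-- The defining property of the product `s = p q` in the symmetric ring of quotients: if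
`a p = r` lies in (the image of) `R` then `a s = r q`, and if `q b = r` lies in `R` then
`s b = p r`. -/
def IsProduct (p q s : SymQuot Fl Fr R) : Prop :=
  (∀ a r : R, a • p = toSymQuot Fl Fr R r → a • s = r • q) ∧
    ∀ b r : R, op b • q = toSymQuot Fl Fr R r → op b • s = op r • p

/-- Pairs `(t, z)` such that `t (p q) = z` has to hold. -/
def prodGens (p q : SymQuot Fl Fr R) : Set (Env R × SymQuot Fl Fr R) :=
  {x | (∃ a r : R, a • p = toSymQuot Fl Fr R r ∧ x = (leftHom a, r • q)) ∨
    ∃ b r : R, op b • q = toSymQuot Fl Fr R r ∧ x = (rightHom (op b), op r • p)}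

/-- Additive families of homomorphisms extend along a map with torsion kernel and cokernel. -/
theorem exists_biext {A : Type u} [Ring A] (F : IdealFilter A) [F.IsGabriel]
    {N P M S : Type*} [AddCommGroup N] [Module A N] [AddCommGroup P] [Module A P]
    [AddCommGroup M] [Module A M] [AddCommGroup S] (φ : N →ₗ[A] P)
    (hk : ∀ n, φ n = 0 → F.IsTorsionElem n)
    (hc : ∀ p : P, ∃ K ∈ F, ∀ a ∈ K, ∃ n, a • p = φ n) (g : S → N →ₗ[A] ModQuot F M)
    (hg : ∀ s s' n, g (s + s') n = g s n + g s' n) :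
    ∃ ρ : S → P →ₗ[A] ModQuot F M,
      (∀ s n, ρ s (φ n) = g s n) ∧ ∀ s s' p, ρ (s + s') p = ρ s p + ρ s' p := by
  choose ρ hρ using fun s => exists_extension hk hc (g s)
  refine ⟨ρ, hρ, fun s s' p => ?_⟩
  have : ρ (s + s') = ρ s + ρ s' :=
    hom_ext_of_torsion hc fun n => by
      rw [LinearMap.add_apply, hρ, hρ, hρ, hg]
  rw [this, LinearMap.add_apply]

theorem left_torsion_of_mem_span {p q z : SymQuot Fl Fr R}
    (h : ((0 : Env R), z) ∈ Submodule.span (Env R) (prodGens p q)) : Fl.IsTorsionElem z := by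
  let φ : R →ₗ[R] SymQuot Fl Fr R :=
    { toFun := toSymQuot Fl Fr R, map_add' := map_add _, map_smul' := toSymQuot_smul }
  let g : SymQuot Fl Fr R → R →ₗ[R] ModQuot Fl (SymQuot Fl Fr R) := fun x =>
    toQuot Fl _ ∘ₗ LinearMap.toSpanSingleton R _ x
  obtain ⟨ρ, hρ, hadd⟩ := exists_biext Fl φ (fun n => exists_left_of_toSymQuot_eq_zero)
    exists_left_smul_mem g (fun s s' n => by simp [g])
  have hρ' : ∀ x r, ρ x (toSymQuot Fl Fr R r) = toQuot Fl _ (r • x) := hρ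
  have hρ'' : ∀ r x, ρ (toSymQuot Fl Fr R r) x = toQuot Fl _ (op r • x) := by
    intro r x
    let rm : SymQuot Fl Fr R →ₗ[R] SymQuot Fl Fr R :=
      { toFun := fun y => op r • y, map_add' := smul_add _,
        map_smul' := fun c y => (smul_comm c (op r) y).symm }
    have : ρ (toSymQuot Fl Fr R r) = toQuot Fl _ ∘ₗ rm := by
      refine hom_ext_of_torsion (φ := φ) exists_left_smul_mem fun n => ?_
      refine (hρ' _ _).trans ?_
      change _ = toQuot Fl _ (op r • toSymQuot Fl Fr R n)
      rw [← toSymQuot_mul, ← toSymQuot_mul']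
    rw [this]
    rfl
  let B : R →+ Rᵐᵒᵖ →+ ModQuot Fl (SymQuot Fl Fr R) :=
    AddMonoidHom.mk' (fun r => AddMonoidHom.mk' (fun s => ρ (s • q) (r • p))
      (fun s s' => by rw [add_smul, hadd])) (fun r r' => by ext s; simp [add_smul])
  let θ : Env R →+ ModQuot Fl (SymQuot Fl Fr R) := TensorProduct.liftAddHom B
    (fun c r s => by rw [map_zsmul, map_zsmul]; rfl)
  have hθ : ∀ r s, θ (r ⊗ₜ s) = ρ (s • q) (r • p) := fun r s => rfl
  have key : ∀ x ∈ Submodule.span (Env R) (prodGens p q), ∀ c : Env R,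
      θ (c * x.1) = toQuot Fl _ (c • x.2) := by
    intro x hx
    induction hx using Submodule.span_induction with
    | mem x hx =>
      intro c
      induction c using TensorProduct.induction_on with
      | zero =>
        have hz : (0 : Env R) • x.2 = 0 := zero_smul (Env R) x.2
        change θ ((0 : Env R) * x.1) = toQuot Fl _ ((0 : Env R) • x.2)
        rw [hz, zero_mul, map_zero, map_zero]
      | add c c' hc hc' => rw [add_mul, map_add, hc, hc', add_smul, map_add]
      | tmul r s =>
        rcases hx with ⟨a, r', h, rfl⟩ | ⟨b, r', h, rfl⟩
        · simp only [leftHom_apply, Algebra.TensorProduct.tmul_mul_tmul, mul_one, hθ, tmul_smul]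
          rw [mul_smul, h, ← toSymQuot_mul, hρ', mul_smul, smul_comm r' s q]
        · simp only [rightHom_apply, Algebra.TensorProduct.tmul_mul_tmul, mul_one, hθ, tmul_smul]
          rw [mul_smul, h]
          obtain ⟨s, rfl⟩ := op_surjective s
          rw [← toSymQuot_mul', hρ'', op_mul, mul_smul, smul_comm r (op s), smul_comm r (op r')]
    | zero => intro c; simp
    | add x y _ _ hx hy =>
      intro c
      rw [Prod.fst_add, Prod.snd_add, mul_add, map_add, hx, hy, smul_add, map_add]
    | smul t x _ hx =>
      intro c
      rw [Prod.smul_fst, Prod.smul_snd, smul_eq_mul, ← mul_assoc, hx, mul_smul]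
  have := key _ h 1
  rw [mul_zero, map_zero, one_smul] at this
  exact toQuot_eq_zero.mp this.symm

theorem right_torsion_of_mem_span {p q z : SymQuot Fl Fr R}
    (h : ((0 : Env R), z) ∈ Submodule.span (Env R) (prodGens p q)) : Fr.IsTorsionElem z := by
  let φ : R →ₗ[Rᵐᵒᵖ] SymQuot Fl Fr R :=
    { toFun := toSymQuot Fl Fr R, map_add' := map_add _, map_smul' := toSymQuot_op_smul }
  let g : SymQuot Fl Fr R → R →ₗ[Rᵐᵒᵖ] ModQuot Fr (SymQuot Fl Fr R) := fun x =>
    toQuot Fr _ ∘ₗ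
      { toFun := fun r => op r • x
        map_add' := fun r r' => by rw [op_add, add_smul]
        map_smul' := fun c r => by rw [RingHom.id_apply, smul_smul]; rfl }
  obtain ⟨ρ, hρ, hadd⟩ := exists_biext Fr φ (fun n => exists_right_of_toSymQuot_eq_zero)
    exists_right_smul_mem g (fun s s' n => by simp [g])
  have hρ' : ∀ x r, ρ x (toSymQuot Fl Fr R r) = toQuot Fr _ (op r • x) := hρ
  have hρ'' : ∀ r x, ρ (toSymQuot Fl Fr R r) x = toQuot Fr _ (r • x) := by
    intro r x
    let rm : SymQuot Fl Fr R →ₗ[Rᵐᵒᵖ] SymQuot Fl Fr R :=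
      { toFun := fun y => r • y, map_add' := smul_add _,
        map_smul' := fun c y => smul_comm r c y }
    have : ρ (toSymQuot Fl Fr R r) = toQuot Fr _ ∘ₗ rm := by
      refine hom_ext_of_torsion (φ := φ) exists_right_smul_mem fun n => ?_
      refine (hρ' _ _).trans ?_
      change _ = toQuot Fr _ (r • toSymQuot Fl Fr R n)
      rw [← toSymQuot_mul, ← toSymQuot_mul']
    rw [this]
    rfl
  let B : R →+ Rᵐᵒᵖ →+ ModQuot Fr (SymQuot Fl Fr R) :=
    AddMonoidHom.mk' (fun r => AddMonoidHom.mk' (fun s => ρ (r • p) (s • q))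
      (fun s s' => by rw [add_smul, map_add])) (fun r r' => by ext s; simp [add_smul, hadd])
  let θ : Env R →+ ModQuot Fr (SymQuot Fl Fr R) := TensorProduct.liftAddHom B
    (fun c r s => by rw [map_zsmul, map_zsmul]; rfl)
  have hθ : ∀ r s, θ (r ⊗ₜ s) = ρ (r • p) (s • q) := fun r s => rfl
  have key : ∀ x ∈ Submodule.span (Env R) (prodGens p q), ∀ c : Env R,
      θ (c * x.1) = toQuot Fr _ (c • x.2) := by
    intro x hx
    induction hx using Submodule.span_induction with
    | mem x hx =>
      intro c
      induction c using TensorProduct.induction_on with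
      | zero =>
        have hz : (0 : Env R) • x.2 = 0 := zero_smul (Env R) x.2
        change θ ((0 : Env R) * x.1) = toQuot Fr _ ((0 : Env R) • x.2)
        rw [hz, zero_mul, map_zero, map_zero]
      | add c c' hc hc' => rw [add_mul, map_add, hc, hc', add_smul, map_add]
      | tmul r s =>
        rcases hx with ⟨a, r', h, rfl⟩ | ⟨b, r', h, rfl⟩
        · simp only [leftHom_apply, Algebra.TensorProduct.tmul_mul_tmul, mul_one, hθ, tmul_smul]
          rw [mul_smul, h, ← toSymQuot_mul, hρ'', mul_smul, smul_comm r' s q]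
        · simp only [rightHom_apply, Algebra.TensorProduct.tmul_mul_tmul, mul_one, hθ, tmul_smul]
          rw [mul_smul, h]
          obtain ⟨s, rfl⟩ := op_surjective s
          rw [← toSymQuot_mul', hρ', op_mul, mul_smul, smul_comm r (op s), smul_comm r (op r')]
    | zero => intro c; simp
    | add x y _ _ hx hy =>
      intro c
      rw [Prod.fst_add, Prod.snd_add, mul_add, map_add, hx, hy, smul_add, map_add]
    | smul t x _ hx =>
      intro c
      rw [Prod.smul_fst, Prod.smul_snd, smul_eq_mul, ← mul_assoc, hx, mul_smul]
  have := key _ h 1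
  rw [mul_zero, map_zero, one_smul] at this
  exact toQuot_eq_zero.mp this.symm

theorem exists_isProduct (p q : SymQuot Fl Fr R) : ∃ s, IsProduct p q s := by
  let G := Submodule.span (Env R) (prodGens p q)
  have uniq : ∀ t z z', (t, z) ∈ G → (t, z') ∈ G → z = z' := by
    intro t z z' h h'
    have : ((0 : Env R), z - z') ∈ G := by simpa using G.sub_mem h h'
    exact sub_eq_zero.mp
      (sym_eq_zero (left_torsion_of_mem_span this) (right_torsion_of_mem_span this))
  let K : Ideal (Env R) := G.map (LinearMap.fst (Env R) (Env R) (SymQuot Fl Fr R))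
  have hK' : ∀ t : K, ∃ z, (t.1, z) ∈ G := by
    rintro ⟨t, ⟨t', z⟩, h, rfl⟩
    exact ⟨z, h⟩
  have mem_l : ∀ a r : R, a • p = toSymQuot Fl Fr R r → (leftHom a, r • q) ∈ G :=
    fun a r h => Submodule.subset_span (Or.inl ⟨a, r, h, rfl⟩)
  have mem_r : ∀ b r : R, op b • q = toSymQuot Fl Fr R r → (rightHom (op b), op r • p) ∈ G :=
    fun b r h => Submodule.subset_span (Or.inr ⟨b, r, h, rfl⟩)
  have hK : K ∈ symmetricFilter Fl Fr := by
    obtain ⟨I, hI, e⟩ := exists_left_smul_mem p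
    obtain ⟨J, hJ, e'⟩ := exists_right_smul_mem q
    rw [mem_symmetricFilter_iff]
    refine ⟨Order.PFilter.mem_of_le (fun a ha => ?_) hI,
      Order.PFilter.mem_of_le (fun b hb => ?_) hJ⟩
    · obtain ⟨r, hr⟩ := e a ha
      exact ⟨_, mem_l a r hr, rfl⟩
    · obtain ⟨r, hr⟩ := e' b hb
      exact ⟨_, mem_r b.unop r hr, rfl⟩
  choose f hf using hK'
  let h : K →ₗ[Env R] SymQuot Fl Fr R :=
    { toFun := f
      map_add' := fun x y => uniq _ _ _ (hf (x + y)) (G.add_mem (hf x) (hf y))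
      map_smul' := fun c x => uniq _ _ _ (hf (c • x)) (G.smul_mem c (hf x)) }
  let _ : Module (Env R) R := TensorProduct.Algebra.module
  obtain ⟨s, hs⟩ := exists_eq_smul (F := symmetricFilter Fl Fr) (M := R) hK h
  have hs' : ∀ t z, (t, z) ∈ G → t • s = z := fun t z htz =>
    (hs t ⟨_, htz, rfl⟩).trans (uniq _ _ _ (hf ⟨t, _, htz, rfl⟩) htz)
  exact ⟨s, fun a r e => hs' _ _ (mem_l a r e), fun b r e => hs' _ _ (mem_r b r e)⟩

instance : Mul (SymQuot Fl Fr R) := ⟨fun p q => (exists_isProduct p q).choose⟩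

instance : One (SymQuot Fl Fr R) := ⟨toSymQuot Fl Fr R 1⟩

theorem sym_one_def : (1 : SymQuot Fl Fr R) = toSymQuot Fl Fr R 1 := rfl

theorem mul_isProduct (p q : SymQuot Fl Fr R) : IsProduct p q (p * q) :=
  (exists_isProduct p q).choose_spec

theorem eq_mul_of_isProduct {p q s : SymQuot Fl Fr R} (h : IsProduct p q s) : s = p * q := by
  obtain ⟨I, hI, e⟩ := exists_left_smul_mem p
  obtain ⟨J, hJ, e'⟩ := exists_right_smul_mem q
  refine sym_ext hI hJ (fun a ha => ?_) fun b hb => ?_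
  · obtain ⟨r, hr⟩ := e a ha
    rw [h.1 a r hr, (mul_isProduct p q).1 a r hr]
  · obtain ⟨r, hr⟩ := e' b hb
    rw [← op_unop b] at hr ⊢
    rw [h.2 _ r hr, (mul_isProduct p q).2 _ r hr]

theorem toSymQuot_mul_eq (r : R) (q : SymQuot Fl Fr R) : toSymQuot Fl Fr R r * q = r • q := by
  simpa using (mul_isProduct (toSymQuot Fl Fr R r) q).1 1 r (one_smul _ _)

theorem mul_toSymQuot_eq (r : R) (p : SymQuot Fl Fr R) : p * toSymQuot Fl Fr R r = op r • p := by
  simpa using (mul_isProduct p (toSymQuot Fl Fr R r)).2 1 r (by simp)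

theorem smul_mul_eq (r : R) (p q : SymQuot Fl Fr R) : (r • p) * q = r • (p * q) := by
  obtain ⟨I, hI, e⟩ := exists_left_smul_mem p
  obtain ⟨J, hJ, e'⟩ := exists_right_smul_mem q
  refine sym_ext (IdealFilter.IsUniform.colon_mem hI r) hJ (fun a ha => ?_) fun b hb => ?_
  · obtain ⟨r', hr⟩ := e _ (Submodule.mem_colon_singleton.mp ha)
    rw [smul_smul, (mul_isProduct p q).1 (a * r) r' hr,
      (mul_isProduct (r • p) q).1 a r' (by rw [smul_smul]; exact hr)]
  · obtain ⟨r', hr⟩ := e' b hb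
    rw [← op_unop b] at hr ⊢
    rw [← smul_comm r (op b.unop) (p * q), (mul_isProduct p q).2 _ r' hr,
      (mul_isProduct (r • p) q).2 _ r' hr, smul_comm r (op r') p]

theorem mul_op_smul_eq (s : Rᵐᵒᵖ) (p q : SymQuot Fl Fr R) : p * (s • q) = s • (p * q) := by
  obtain ⟨I, hI, e⟩ := exists_left_smul_mem p
  obtain ⟨J, hJ, e'⟩ := exists_right_smul_mem q
  refine sym_ext hI (IdealFilter.IsUniform.colon_mem hJ s) (fun a ha => ?_) fun b hb => ?_
  · obtain ⟨r', hr⟩ := e a ha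
    rw [smul_comm a s, (mul_isProduct p q).1 a r' hr,
      (mul_isProduct p (s • q)).1 a r' hr, smul_comm]
  · obtain ⟨r', hr⟩ := e' _ (Submodule.mem_colon_singleton.mp hb)
    obtain ⟨b, rfl⟩ := op_surjective b
    obtain ⟨s, rfl⟩ := op_surjective s
    rw [smul_eq_mul, ← op_mul] at hr
    rw [smul_smul, ← op_mul, (mul_isProduct p q).2 _ r' hr,
      (mul_isProduct p (op s • q)).2 b r' (by rw [smul_smul, ← op_mul]; exact hr)]

/-- The symmetric ring of quotients. -/
instance : Ring (SymQuot Fl Fr R) :=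
  { (inferInstance : AddCommGroup (SymQuot Fl Fr R)), (inferInstance : Mul (SymQuot Fl Fr R)),
    (inferInstance : One (SymQuot Fl Fr R)) with
    one_mul := fun q => by rw [sym_one_def, toSymQuot_mul_eq, one_smul]
    mul_one := fun q => by rw [sym_one_def, mul_toSymQuot_eq, op_one, one_smul]
    zero_mul := fun q => by
      rw [← map_zero (toSymQuot Fl Fr R), toSymQuot_mul_eq, zero_smul, map_zero]
    mul_zero := fun q => by
      rw [← map_zero (toSymQuot Fl Fr R), mul_toSymQuot_eq, op_zero, zero_smul, map_zero]
    left_distrib := fun p q q' => by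
      obtain ⟨I, hI, e⟩ := exists_left_smul_mem p
      obtain ⟨J, hJ, f⟩ := exists_right_smul_mem q
      obtain ⟨J', hJ', f'⟩ := exists_right_smul_mem q'
      refine sym_ext hI (Fr.inf_mem hJ hJ') (fun a ha => ?_) fun b hb => ?_
      · obtain ⟨r, hr⟩ := e a ha
        rw [smul_add, (mul_isProduct _ _).1 a r hr, (mul_isProduct _ _).1 a r hr,
          (mul_isProduct _ _).1 a r hr, smul_add]
      · obtain ⟨r, hr⟩ := f b hb.1
        obtain ⟨r', hr'⟩ := f' b hb.2
        obtain ⟨b, rfl⟩ := op_surjective b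
        rw [smul_add, (mul_isProduct _ _).2 b r hr, (mul_isProduct _ _).2 b r' hr',
          (mul_isProduct _ _).2 b (r + r') (by rw [smul_add, hr, hr', map_add]), op_add, add_smul]
    right_distrib := fun p p' q => by
      obtain ⟨I, hI, e⟩ := exists_left_smul_mem p
      obtain ⟨I', hI', e'⟩ := exists_left_smul_mem p'
      obtain ⟨J, hJ, f⟩ := exists_right_smul_mem q
      refine sym_ext (Fl.inf_mem hI hI') hJ (fun a ha => ?_) fun b hb => ?_
      · obtain ⟨r, hr⟩ := e a ha.1
        obtain ⟨r', hr'⟩ := e' a ha.2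
        rw [smul_add, (mul_isProduct _ _).1 a r hr, (mul_isProduct _ _).1 a r' hr',
          (mul_isProduct _ _).1 a (r + r') (by rw [smul_add, hr, hr', map_add]), add_smul]
      · obtain ⟨r, hr⟩ := f b hb
        obtain ⟨b, rfl⟩ := op_surjective b
        rw [smul_add, (mul_isProduct _ _).2 b r hr, (mul_isProduct _ _).2 b r hr,
          (mul_isProduct _ _).2 b r hr, smul_add]
    mul_assoc := fun p q w => by
      obtain ⟨I, hI, e⟩ := exists_left_smul_mem p
      obtain ⟨J, hJ, f⟩ := exists_right_smul_mem w
      refine sym_ext hI hJ (fun a ha => ?_) fun b hb => ?_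
      · obtain ⟨r, hr⟩ := e a ha
        rw [← smul_mul_eq, (mul_isProduct p q).1 a r hr, smul_mul_eq,
          (mul_isProduct p (q * w)).1 a r hr]
      · obtain ⟨r, hr⟩ := f b hb
        obtain ⟨b, rfl⟩ := op_surjective b
        rw [(mul_isProduct (p * q) w).2 b r hr, ← mul_op_smul_eq (op b) p,
          (mul_isProduct q w).2 b r hr, mul_op_smul_eq] }

end Ring

/-! ### Derivations -/

section Derivations

/-- A derivation of a (not necessarily commutative) ring. -/
def IsRingDerivation {S : Type*} [Ring S] (δ : S →+ S) : Prop :=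
  ∀ r s, δ (r * s) = δ r * s + r * δ s

/-- A `δ`-derivation of an `R`-bimodule: `d (x r) = d x r + x δ r` and `d (r x) = δ r x + r d x`. -/
def IsBimoduleDerivation {M : Type*} [AddCommGroup M] [Module R M] [Module Rᵐᵒᵖ M]
    (δ : R →+ R) (d : M →+ M) : Prop :=
  (∀ (x : M) (r : R), d (op r • x) = op r • d x + op (δ r) • x) ∧
    ∀ (r : R) (x : M), d (r • x) = δ r • x + r • d x

/-- The map on the enveloping ring induced by `δ`: `r ⊗ s ↦ δ r ⊗ s + r ⊗ δ s`. -/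
def envDerivation (δ : R →+ R) : Env R →+ Env R :=
  (TensorProduct.map δ.toIntLinearMap LinearMap.id +
    TensorProduct.map LinearMap.id (AddMonoidHom.mulOp δ).toIntLinearMap :
      Env R →ₗ[ℤ] Env R).toAddMonoidHom

theorem envDerivation_tmul (δ : R →+ R) (r s : R) :
    envDerivation δ (r ⊗ₜ[ℤ] op s) = δ r ⊗ₜ[ℤ] op s + r ⊗ₜ[ℤ] op (δ s) := rfl

/-- The symmetric filter is differential: for every derivation `δ` of `R`, every member `I` of the
filter contains the image under the derivation of `R ⊗ Rᵒᵖ` induced by `δ` of some member `J`. -/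
def SymDifferential (Fl : IdealFilter R) (Fr : IdealFilter Rᵐᵒᵖ) : Prop :=
  ∀ δ : R →+ R, IsRingDerivation δ → ∀ I ∈ symmetricFilter Fl Fr, ∃ J ∈ symmetricFilter Fl Fr,
    ∀ t ∈ J, envDerivation δ t ∈ I

/-- The symmetric filter is faithful: the bimodule `R` is torsion-free. -/
def SymFaithful (Fl : IdealFilter R) (Fr : IdealFilter Rᵐᵒᵖ) [Fl.IsGabriel] [Fr.IsGabriel] : Prop :=
  SymTorsionFree Fl Fr R

/-- The maps `d₁` and `d₂` on the symmetric modules of quotients extend `d`, and they agree: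
`d₁ q₁ = q₁ d`, `d₂ q₂ = q₂ d` and `d₂ q₁₂ = q₁₂ d₁`. -/
structure ExtensionsAgree {M : Type*} [AddCommGroup M] [Module R M] [Module Rᵐᵒᵖ M]
    [SMulCommClass R Rᵐᵒᵖ M] {Fl₁ Fl₂ : IdealFilter R} {Fr₁ Fr₂ : IdealFilter Rᵐᵒᵖ}
    [Fl₁.IsGabriel] [Fl₂.IsGabriel] [Fr₁.IsGabriel] [Fr₂.IsGabriel]
    (h : symmetricFilter Fl₁ Fr₁ ≤ symmetricFilter Fl₂ Fr₂) (d : M →+ M)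
    (d₁ : SymQuot Fl₁ Fr₁ M →+ SymQuot Fl₁ Fr₁ M)
    (d₂ : SymQuot Fl₂ Fr₂ M →+ SymQuot Fl₂ Fr₂ M) : Prop where
  extends_first : ∀ m, d₁ (toSymQuot Fl₁ Fr₁ M m) = toSymQuot Fl₁ Fr₁ M (d m)
  extends_second : ∀ m, d₂ (toSymQuot Fl₂ Fr₂ M m) = toSymQuot Fl₂ Fr₂ M (d m)
  agree : ∀ z, d₂ (symTransition M h z) = symTransition M h (d₁ z)

end Derivations

end Bimodule

end TorsionQuotient
end

open TorsionQuotient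

namespace TorsionQuotient

/-! ## Extension of derivations to modules of quotients -/

section Generic

variable {A : Type*} [Ring A] {F G : IdealFilter A} [F.IsGabriel] [G.IsGabriel]
  {M : Type*} [AddCommGroup M] [Module A M] {D : A →+ A} {d : M →+ M}

/-! A `δ`-derivation of a bimodule is the same thing as a derivation of the corresponding `Env
R`-module over `envDerivation δ`. The extension problem is therefore one about a ring `A` with a
derivation `D`, a Gabriel filter `F` and the canonical map `q : M → M_F`.

If `d'` is an extension of `d` obeying the Leibniz rule, then `a • d' z = q (d m) - D a • z`
whenever `a • z = q m`. The elements `a` for which such an `m` exists form a member of `F`, and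
`M_F` is torsion-free, so this condition determines `d' z`. Conversely, if `d` sends torsion
elements to torsion elements, the right-hand side depends only on `a` and `z` and is `A`-linear in
`a`; since every homomorphism from a member of `F` to `M_F` is a multiplication (`exists_eq_smul`),
the required value exists (`exists_isDerivationValue`). Agreement for two filters costs nothing: the
same uniqueness argument, run in the larger filter, forces it.

What remains is to see that `d` preserves torsion for both filters. For a differential filter this
is the Leibniz rule. Under i), torsion for the second filter is already torsion for the first, which
is differential. For faithful filters the torsion of `R` is zero.

For `M = R`, the Leibniz rule for products in the ring of quotients follows from the two bimodule
rules, because products are detected by multiplying with elements of `R` that move a factor into the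
image of `R`. -/

theorem IsRingDerivation.map_one {S : Type*} [Ring S] {D : S →+ S} (hD : IsRingDerivation D) :
    D 1 = 0 := by
  simpa using hD 1 1

/-- A `D`-derivation of a left module over a ring with a derivation `D`. -/
def IsModuleDerivation {N : Type*} [AddCommGroup N] [Module A N] (D : A →+ A) (d : N →+ N) : Prop :=
  ∀ (a : A) (x : N), d (a • x) = D a • x + a • d x

/-- Derivations preserve the torsion submodule of a differential filter. -/
theorem IsModuleDerivation.isTorsionElem {F : IdealFilter A} (hd : IsModuleDerivation D d)
    (hF : ∀ I ∈ F, ∃ J ∈ F, ∀ a ∈ J, D a ∈ I) {m : M} (hm : F.IsTorsionElem m) :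
    F.IsTorsionElem (d m) := by
  obtain ⟨I, hI, h⟩ := hm
  obtain ⟨J, hJ, hJI⟩ := hF I hI
  -- For `a` in `I ⊓ J` both `a • m` and `D a • m` vanish, so expanding `d (a • m) = 0` leaves only
  -- `a • d m`.
  refine ⟨I ⊓ J, F.inf_mem hI hJ, fun a ha => ?_⟩
  have := hd a m
  rwa [h a ha.1, map_zero, h _ (hJI a ha.2), zero_add, eq_comm] at this

/-- If `a z = q m` then `a w = q (d m) - D a z`: the condition that `w` is the value at `z` of an
extension of `d` to the module of quotients. -/
def IsDerivationValue (D : A →+ A) (d : M →+ M) (z w : ModQuot F M) : Prop :=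
  ∀ (a : A) (m : M), a • z = toQuot F M m → a • w = toQuot F M (d m) - D a • z

/-- The prescribed value of `a • w` is linear in `a`: in the Leibniz expansion for `c * a`, the term
`D c • (a • z)` from `D (c * a) • z` cancels the term `q (D c • m)` from `q (d (c • m))`.
Preservation of torsion is what makes the value independent of the choice of `m`. -/
theorem exists_isDerivationValue (hD : IsRingDerivation D) (hd : IsModuleDerivation D d)
    (ht : ∀ m, F.IsTorsionElem m → F.IsTorsionElem (d m)) (z : ModQuot F M) :
    ∃ w, IsDerivationValue D d z w := by
  have hq : ∀ m m', toQuot F M m = toQuot F M m' → toQuot F M (d m) = toQuot F M (d m') := by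
    intro m m' e
    rw [← sub_eq_zero, ← map_sub, toQuot_eq_zero] at e
    rw [← sub_eq_zero, ← map_sub, ← map_sub, toQuot_eq_zero]
    exact ht _ e
  -- The ideal of all `a` with `a • z` in the image of `M`. Taking the largest possible domain
  -- yields the condition on `w` for every admissible pair `(a, m)` at once.
  let K : Ideal A := (LinearMap.range (toQuot F M)).comap (LinearMap.toSpanSingleton A _ z)
  have memK : ∀ a, a ∈ K ↔ ∃ m, a • z = toQuot F M m := fun a =>
    ⟨fun ⟨m, hm⟩ => ⟨m, hm.symm⟩, fun ⟨m, hm⟩ => ⟨m, hm.symm⟩⟩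
  have hK : K ∈ F := by
    obtain ⟨L, hL, e⟩ := exists_smul_mem_range z
    exact Order.PFilter.mem_of_le (fun a ha => (memK a).mpr (e a ha)) hL
  choose n hn using fun a : K => (memK a.1).mp a.2
  let g : K →ₗ[A] ModQuot F M :=
    { toFun := fun a => toQuot F M (d (n a)) - D a.1 • z
      map_add' := fun a b => by
        have : toQuot F M (d (n (a + b))) = toQuot F M (d (n a + n b)) :=
          hq _ _ (by rw [← hn, map_add, ← hn, ← hn, ← add_smul]; rfl)
        rw [this, map_add, map_add, Submodule.coe_add, map_add, add_smul]
        abel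
      map_smul' := fun c a => by
        have : toQuot F M (d (n (c • a))) = toQuot F M (d (c • n a)) :=
          hq _ _ (by rw [← hn, map_smul, ← hn, smul_smul]; rfl)
        rw [this, hd, map_add, map_smul, map_smul, Submodule.coe_smul, smul_eq_mul, hD, add_smul,
          mul_smul, hn, RingHom.id_apply, smul_sub, mul_smul]
        abel }
  obtain ⟨w, hw⟩ := exists_eq_smul hK g
  refine ⟨w, fun a m e => ?_⟩
  have ha : a ∈ K := (memK a).mpr ⟨m, e⟩
  rw [hw a ha]
  change toQuot F M (d (n ⟨a, ha⟩)) - D a • z = _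
  rw [hq _ m (by rw [← hn, ← e])]

/-- A derivation that preserves the torsion submodule extends to the module of quotients. -/
theorem exists_derivation_extension (hD : IsRingDerivation D) (hd : IsModuleDerivation D d)
    (ht : ∀ m, F.IsTorsionElem m → F.IsTorsionElem (d m)) :
    ∃ d' : ModQuot F M →+ ModQuot F M,
      IsModuleDerivation D d' ∧ ∀ m, d' (toQuot F M m) = toQuot F M (d m) := by
  choose e he using exists_isDerivationValue (F := F) hD hd ht
  refine ⟨AddMonoidHom.mk' e fun z z' => ?_, fun b z => ?_, fun m => ?_⟩
  · obtain ⟨K, hK, h⟩ := exists_smul_mem_range z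
    obtain ⟨K', hK', h'⟩ := exists_smul_mem_range z'
    refine eq_of_smul (F.inf_mem hK hK') fun a ha => ?_
    obtain ⟨m, hm⟩ := h a ha.1
    obtain ⟨m', hm'⟩ := h' a ha.2
    rw [smul_add, he _ a m hm, he _ a m' hm',
      he _ a (m + m') (by rw [smul_add, hm, hm', map_add]), map_add, map_add, smul_add]
    abel
  · obtain ⟨K, hK, h⟩ := exists_smul_mem_range z
    -- For `a` in `(K : b)` one element `m` serves twice: `a • (b • z)` and `(a * b) • z` both equal
    -- `q m`. This evaluates `a • e (b • z)` and `a • b • e z` through the same `q (d m)`.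
    refine eq_of_smul (IdealFilter.IsUniform.colon_mem hK b) fun a ha => ?_
    obtain ⟨m, hm⟩ := h _ (Submodule.mem_colon_singleton.mp ha)
    change a • e (b • z) = a • (D b • z + b • e z)
    rw [smul_eq_mul] at hm
    rw [he _ a m (by rw [smul_smul, hm]), smul_add, smul_smul a b (e z), he _ _ m hm, hD,
      add_smul, mul_smul, mul_smul]
    abel
  · have := he (toQuot F M m) 1 m (one_smul _ _)
    rwa [one_smul, hD.map_one, zero_smul, sub_zero] at this

/-- Extensions of a derivation to the modules of quotients for two filters agree. -/
theorem derivation_extensions_agree (h : F ≤ G) {d₁ : ModQuot F M →+ ModQuot F M}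
    {d₂ : ModQuot G M →+ ModQuot G M} (hd₁ : IsModuleDerivation D d₁)
    (hd₂ : IsModuleDerivation D d₂) (h₁ : ∀ m, d₁ (toQuot F M m) = toQuot F M (d m))
    (h₂ : ∀ m, d₂ (toQuot G M m) = toQuot G M (d m)) (z : ModQuot F M) :
    d₂ (transitionHom M h z) = transitionHom M h (d₁ z) := by
  obtain ⟨K, hK, e⟩ := exists_smul_mem_range z
  -- A member of `F` is also one of `G`, and `M_G` is `G`-torsion-free, so testing on `K` suffices.
  -- There both sides become `q_G (d m) - D a • (transitionHom M h z)`.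
  refine eq_of_smul (h hK) fun a ha => ?_
  obtain ⟨m, hm⟩ := e a ha
  have e₁ := congrArg (transitionHom M h) (hd₁ a z)
  have e₂ := hd₂ a (transitionHom M h z)
  rw [hm, h₁, transitionHom_toQuot, map_add, transitionHom_smul, transitionHom_smul] at e₁
  rw [← transitionHom_smul, hm, transitionHom_toQuot, h₂, e₁] at e₂
  exact (add_left_cancel e₂).symm

end Generic

/-! ### Bimodule derivations as derivations over the enveloping ring -/

section Bimodule

open MulOpposite

attribute [local instance] TensorProduct.Algebra.module

variable {R : Type*} [Ring R] {δ : R →+ R}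

theorem isRingDerivation_envDerivation (hδ : IsRingDerivation δ) :
    IsRingDerivation (envDerivation δ) := by
  intro x y
  induction x using TensorProduct.induction_on with
  | zero => simp
  | add x x' hx hx' => rw [add_mul, map_add, hx, hx', map_add, add_mul, add_mul]; abel
  | tmul r s =>
    induction y using TensorProduct.induction_on with
    | zero => simp
    | add y y' hy hy' => rw [mul_add, map_add, hy, hy', map_add, mul_add, mul_add]; abel
    | tmul r' s' =>
      obtain ⟨s, rfl⟩ := op_surjective s
      obtain ⟨s', rfl⟩ := op_surjective s'
      rw [Algebra.TensorProduct.tmul_mul_tmul, ← op_mul, envDerivation_tmul, envDerivation_tmul,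
        envDerivation_tmul, hδ, hδ, op_add, add_mul, mul_add]
      simp only [Algebra.TensorProduct.tmul_mul_tmul, TensorProduct.add_tmul,
        TensorProduct.tmul_add, op_mul]
      abel

/-- Since `δ 1 = 0`, the induced derivation restricts to `δ` on each copy of `R`; this recovers the
two one-sided rules from the Leibniz rule over `Env R`. -/
theorem envDerivation_leftHom (hδ : IsRingDerivation δ) (r : R) :
    envDerivation δ (leftHom r) = leftHom (δ r) := by
  rw [leftHom_apply, leftHom_apply, ← op_one, envDerivation_tmul, hδ.map_one, op_zero,
    TensorProduct.tmul_zero, add_zero]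

theorem envDerivation_rightHom (hδ : IsRingDerivation δ) (s : R) :
    envDerivation δ (rightHom (op s)) = rightHom (op (δ s)) := by
  rw [rightHom_apply, rightHom_apply, envDerivation_tmul, hδ.map_one, TensorProduct.zero_tmul,
    zero_add]

/-! ### Preservation of torsion and extension to symmetric modules of quotients -/

section Modules

variable {M : Type*} [AddCommGroup M] [Module R M] [Module Rᵐᵒᵖ M] [SMulCommClass R Rᵐᵒᵖ M]
  {d : M →+ M}

/-- A pure tensor acts as a left multiplication after a right one, so applying the two rules in turn
gives the three terms of the Leibniz rule; additivity does the rest. -/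
theorem IsBimoduleDerivation.isModuleDerivation (hd : IsBimoduleDerivation δ d) :
    IsModuleDerivation (envDerivation δ) d := by
  intro t x
  induction t using TensorProduct.induction_on with
  | zero =>
    have hz (y : M) : (0 : Env R) • y = 0 := zero_smul (Env R) y
    rw [map_zero, hz, hz, map_zero, add_zero]
  | add t t' ht ht' => rw [add_smul, map_add, ht, ht', map_add, add_smul, add_smul]; abel
  | tmul r s =>
    obtain ⟨s, rfl⟩ := op_surjective s
    rw [envDerivation_tmul, add_smul, TensorProduct.Algebra.smul_def,
      TensorProduct.Algebra.smul_def, TensorProduct.Algebra.smul_def,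
      TensorProduct.Algebra.smul_def, hd.2, hd.1, smul_add]
    abel

variable {Fl Fl₁ Fl₂ : IdealFilter R} {Fr Fr₁ Fr₂ : IdealFilter Rᵐᵒᵖ}
  [Fl.IsGabriel] [Fr.IsGabriel] [Fl₁.IsGabriel] [Fl₂.IsGabriel] [Fr₁.IsGabriel] [Fr₂.IsGabriel]

theorem isBimoduleDerivation_of_isModuleDerivation (hδ : IsRingDerivation δ)
    {d' : SymQuot Fl Fr M →+ SymQuot Fl Fr M}
    (hd' : IsModuleDerivation (A := Env R) (N := ModQuot (symmetricFilter Fl Fr) M)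
      (envDerivation δ) d') :
    IsBimoduleDerivation δ d' := by
  constructor
  · intro x r
    refine (hd' (rightHom (op r)) x).trans ?_
    rw [envDerivation_rightHom hδ, add_comm]
    rfl
  · intro r x
    refine (hd' (leftHom r) x).trans ?_
    rw [envDerivation_leftHom hδ]
    rfl

/-- A `δ`-derivation that preserves the torsion submodules for two symmetric filters has extensions
to the symmetric modules of quotients that agree. -/
theorem exists_extensionsAgree (h : symmetricFilter Fl₁ Fr₁ ≤ symmetricFilter Fl₂ Fr₂)
    (hδ : IsRingDerivation δ) (hd : IsBimoduleDerivation δ d)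
    (ht₁ : ∀ m, (symmetricFilter Fl₁ Fr₁).IsTorsionElem m →
      (symmetricFilter Fl₁ Fr₁).IsTorsionElem (d m))
    (ht₂ : ∀ m, (symmetricFilter Fl₂ Fr₂).IsTorsionElem m →
      (symmetricFilter Fl₂ Fr₂).IsTorsionElem (d m)) :
    ∃ (d₁ : SymQuot Fl₁ Fr₁ M →+ SymQuot Fl₁ Fr₁ M)
      (d₂ : SymQuot Fl₂ Fr₂ M →+ SymQuot Fl₂ Fr₂ M),
      IsBimoduleDerivation δ d₁ ∧ IsBimoduleDerivation δ d₂ ∧ ExtensionsAgree h d d₁ d₂ := by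
  have hD := isRingDerivation_envDerivation hδ
  obtain ⟨d₁, hd₁, h₁⟩ := exists_derivation_extension hD hd.isModuleDerivation ht₁
  obtain ⟨d₂, hd₂, h₂⟩ := exists_derivation_extension hD hd.isModuleDerivation ht₂
  exact ⟨d₁, d₂, isBimoduleDerivation_of_isModuleDerivation hδ hd₁,
    isBimoduleDerivation_of_isModuleDerivation hδ hd₂,
    h₁, h₂, derivation_extensions_agree h hd₁ hd₂ h₁ h₂⟩

/-- Homomorphisms of bimodules are linear over the enveloping ring. -/
theorem map_env_smul {N P : Type*} [AddCommGroup N] [Module R N] [Module Rᵐᵒᵖ N]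
    [SMulCommClass R Rᵐᵒᵖ N] [AddCommGroup P] [Module R P] [Module Rᵐᵒᵖ P]
    [SMulCommClass R Rᵐᵒᵖ P] (f : N →+ P) (hl : ∀ (r : R) x, f (r • x) = r • f x)
    (hr : ∀ (s : Rᵐᵒᵖ) x, f (s • x) = s • f x) (t : Env R) (x : N) : f (t • x) = t • f x := by
  induction t using TensorProduct.induction_on with
  | zero =>
    have hN : (0 : Env R) • x = 0 := zero_smul (Env R) x
    have hP : (0 : Env R) • f x = 0 := zero_smul (Env R) (f x)
    rw [hN, hP, map_zero]
  | add t t' ht ht' => rw [add_smul, map_add, ht, ht', add_smul]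
  | tmul r s =>
    rw [TensorProduct.Algebra.smul_def, TensorProduct.Algebra.smul_def, hl, hr]

theorem SymTorsionFree.eq_zero (hf : SymTorsionFree Fl Fr M) {x : M}
    (hx : (symmetricFilter Fl Fr).IsTorsionElem x) : x = 0 :=
  (Submodule.mem_bot (Env R)).mp
    ((show torsion (symmetricFilter Fl Fr) M = ⊥ from hf) ▸
      (show x ∈ torsion (symmetricFilter Fl Fr) M from hx))

/-- `SymTorsionFree` refers to the `Env R`-action assembled from the two one-sided actions, not to
the one carried by the direct limit. Using only one-sided linearity lets torsion be transported
along `toSymQuot` for the former action. -/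
theorem isTorsionElem_map_of_bimodule_hom {N P : Type*} [AddCommGroup N] [Module R N]
    [Module Rᵐᵒᵖ N] [SMulCommClass R Rᵐᵒᵖ N] [AddCommGroup P] [Module R P] [Module Rᵐᵒᵖ P]
    [SMulCommClass R Rᵐᵒᵖ P] (F : IdealFilter (Env R)) (f : N →+ P)
    (hl : ∀ (r : R) x, f (r • x) = r • f x) (hr : ∀ (s : Rᵐᵒᵖ) x, f (s • x) = s • f x) {x : N}
    (hx : F.IsTorsionElem x) : F.IsTorsionElem (f x) := by
  obtain ⟨K, hK, e⟩ := hx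
  exact ⟨K, hK, fun a ha => by rw [← map_env_smul f hl hr, e a ha, map_zero]⟩

/-- The image of `m` in the first module of quotients is torsion for the second filter, hence zero,
and the kernel of `toSymQuot` is the torsion for the first filter. -/
theorem isTorsionElem_of_symTorsionFree
    (hf : SymTorsionFree Fl₂ Fr₂ (SymQuot Fl₁ Fr₁ M)) {m : M}
    (hm : (symmetricFilter Fl₂ Fr₂).IsTorsionElem m) :
    (symmetricFilter Fl₁ Fr₁).IsTorsionElem m :=
  toQuot_eq_zero.mp (hf.eq_zero (isTorsionElem_map_of_bimodule_hom _ (toSymQuot Fl₁ Fr₁ M)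
    toSymQuot_smul toSymQuot_op_smul hm))

theorem IsBimoduleDerivation.isTorsionElem_of_symDifferential {Fl : IdealFilter R}
    {Fr : IdealFilter Rᵐᵒᵖ} (hF : SymDifferential Fl Fr)
    (hδ : IsRingDerivation δ) (hd : IsBimoduleDerivation δ d) {m : M}
    (hm : (symmetricFilter Fl Fr).IsTorsionElem m) :
    (symmetricFilter Fl Fr).IsTorsionElem (d m) :=
  hd.isModuleDerivation.isTorsionElem (hF δ hδ) hm

/-- Under i) the element is already torsion for the first filter. That filter being differential, `d
m` is torsion for it too, and its members belong to the second filter. -/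
theorem IsBimoduleDerivation.isTorsionElem_of_le
    (h : symmetricFilter Fl₁ Fr₁ ≤ symmetricFilter Fl₂ Fr₂) (h₁ : SymDifferential Fl₁ Fr₁)
    (h₂ : SymTorsionFree Fl₂ Fr₂ (SymQuot Fl₁ Fr₁ M) ∨ SymDifferential Fl₂ Fr₂)
    (hδ : IsRingDerivation δ) (hd : IsBimoduleDerivation δ d) {m : M}
    (hm : (symmetricFilter Fl₂ Fr₂).IsTorsionElem m) :
    (symmetricFilter Fl₂ Fr₂).IsTorsionElem (d m) := by
  rcases h₂ with hf | hF
  · obtain ⟨K, hK, e⟩ :=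
      hd.isTorsionElem_of_symDifferential h₁ hδ (isTorsionElem_of_symTorsionFree hf hm)
    exact ⟨K, h hK, e⟩
  · exact hd.isTorsionElem_of_symDifferential hF hδ hm

end Modules

/-! ### Derivations of the symmetric ring of quotients -/

section Ring

variable {Fl : IdealFilter R} {Fr : IdealFilter Rᵐᵒᵖ} [Fl.IsGabriel] [Fr.IsGabriel]

theorem IsRingDerivation.isBimoduleDerivation (hδ : IsRingDerivation δ) :
    IsBimoduleDerivation δ δ :=
  ⟨hδ, hδ⟩

theorem SymFaithful.isTorsionElem_map (hf : SymFaithful Fl Fr) {r : R}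
    (hr : (symmetricFilter Fl Fr).IsTorsionElem r) :
    (symmetricFilter Fl Fr).IsTorsionElem (δ r) := by
  rw [SymTorsionFree.eq_zero hf hr, map_zero]
  exact (torsion (symmetricFilter Fl Fr) R).zero_mem

/-- An extension of a derivation of `R` to a derivation of the bimodule of symmetric quotients is a
derivation of the symmetric ring of quotients. -/
theorem IsBimoduleDerivation.isRingDerivation {d : SymQuot Fl Fr R →+ SymQuot Fl Fr R}
    (hd : IsBimoduleDerivation δ d)
    (he : ∀ r, d (toSymQuot Fl Fr R r) = toSymQuot Fl Fr R (δ r)) : IsRingDerivation d := by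
  intro p q
  obtain ⟨I, hI, e⟩ := exists_left_smul_mem p
  obtain ⟨J, hJ, e'⟩ := exists_right_smul_mem q
  refine sym_ext hI hJ (fun a ha => ?_) fun b hb => ?_
  · obtain ⟨r, hr⟩ := e a ha
    -- With `a • p` equal to the image of `r`, the element `d (a • (p * q)) = d (r • q)` is expanded
    -- in two ways. In the result `a • d p` is the image of `δ r` minus `δ a • p`, by the same rule
    -- applied to `a • p`. The right-hand case below is the mirror image.
    have h₁ := hd.2 a (p * q)
    have h₂ := hd.2 a p
    rw [← smul_mul_eq, hr, toSymQuot_mul_eq, hd.2, ← smul_mul_eq] at h₁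
    rw [hr, he, ← sub_eq_iff_eq_add'] at h₂
    rw [smul_add, ← smul_mul_eq, ← smul_mul_eq, hr, ← h₂, sub_mul, toSymQuot_mul_eq,
      toSymQuot_mul_eq, sub_add_eq_add_sub, h₁, add_sub_cancel_left]
  · obtain ⟨r, hr⟩ := e' b hb
    obtain ⟨b, rfl⟩ := op_surjective b
    have h₁ := hd.1 (p * q) b
    have h₂ := hd.1 q b
    rw [← mul_op_smul_eq, hr, mul_toSymQuot_eq, hd.1, ← mul_op_smul_eq (op (δ b))] at h₁
    rw [hr, he, ← sub_eq_iff_eq_add] at h₂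
    rw [smul_add, ← mul_op_smul_eq, ← mul_op_smul_eq, hr, ← h₂, mul_sub, mul_toSymQuot_eq,
      mul_toSymQuot_eq, ← add_sub_assoc, h₁, add_sub_cancel_right]

end Ring

end Bimodule

end TorsionQuotient

theorem mainTheorem8 {R : Type*} [Ring R]
    (Fl₁ Fl₂ : IdealFilter R) (Fr₁ Fr₂ : IdealFilter Rᵐᵒᵖ)
    [Fl₁.IsGabriel] [Fl₂.IsGabriel] [Fr₁.IsGabriel] [Fr₂.IsGabriel]
    (h : symmetricFilter Fl₁ Fr₁ ≤ symmetricFilter Fl₂ Fr₂) :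
    (SymDifferential Fl₁ Fr₁ →
      ∀ (M : Type*) [AddCommGroup M] [Module R M] [Module Rᵐᵒᵖ M] [SMulCommClass R Rᵐᵒᵖ M],
        SymTorsionFree Fl₂ Fr₂ (SymQuot Fl₁ Fr₁ M) ∨ SymDifferential Fl₂ Fr₂ →
        ∀ (δ : R →+ R) (d : M →+ M), IsRingDerivation δ → IsBimoduleDerivation δ d →
          ∃ (d₁ : SymQuot Fl₁ Fr₁ M →+ SymQuot Fl₁ Fr₁ M)
            (d₂ : SymQuot Fl₂ Fr₂ M →+ SymQuot Fl₂ Fr₂ M),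
            IsBimoduleDerivation δ d₁ ∧ IsBimoduleDerivation δ d₂ ∧ ExtensionsAgree h d d₁ d₂) ∧
    ((SymDifferential Fl₁ Fr₁ ∧
          (SymTorsionFree Fl₂ Fr₂ (SymQuot Fl₁ Fr₁ R) ∨ SymDifferential Fl₂ Fr₂)) ∨
        (SymFaithful Fl₁ Fr₁ ∧ SymFaithful Fl₂ Fr₂) →
      ∀ δ : R →+ R, IsRingDerivation δ →
        ∃ (d₁ : SymQuot Fl₁ Fr₁ R →+ SymQuot Fl₁ Fr₁ R)
          (d₂ : SymQuot Fl₂ Fr₂ R →+ SymQuot Fl₂ Fr₂ R),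
          IsRingDerivation d₁ ∧ IsRingDerivation d₂ ∧
          IsBimoduleDerivation δ d₁ ∧ IsBimoduleDerivation δ d₂ ∧
          ExtensionsAgree h δ d₁ d₂) := by
  refine ⟨fun h₁ M _ _ _ _ h₂ δ d hδ hd => ?_, fun hyp δ hδ => ?_⟩
  · exact exists_extensionsAgree h hδ hd
      (fun _ => hd.isTorsionElem_of_symDifferential h₁ hδ)
      fun _ => hd.isTorsionElem_of_le h h₁ h₂ hδ
  · have hd := hδ.isBimoduleDerivation
    -- The bimodule statement is applied to `M = R` and `d = δ`; either alternative of the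
    -- hypothesis enters only through preservation of torsion.
    obtain ⟨d₁, d₂, hd₁, hd₂, he⟩ := exists_extensionsAgree h hδ hd
      (fun r hr => hyp.elim (fun hF => hd.isTorsionElem_of_symDifferential hF.1 hδ hr)
        fun hF => hF.1.isTorsionElem_map hr)
      (fun r hr => hyp.elim (fun hF => hd.isTorsionElem_of_le h hF.1 hF.2 hδ hr)
        fun hF => hF.2.isTorsionElem_map hr)
    exact ⟨d₁, d₂, hd₁.isRingDerivation he.extends_first, hd₂.isRingDerivation he.extends_second,
      hd₁, hd₂, he⟩
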